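/- **Model.** Let $G$ be a connected, undirected, unweighted graph on the node set $[n]$ (each node is its own identifier), and let $\gamma\ge 1$ be an integer. In the $\mathsf{HYBRID}(\infty,\gamma)$ model, computationally unbounded nodes run in synchronous rounds. Initially a node knows $n$, its identifier, the identifiers of its neighbours in $G$, and the outcome of its random coins. In each round it sends, depending on its state, one bit string of arbitrary length to each neighbour in $G$ (local mode), and nonempty bit strings to arbitrary nodes (global mode); it then computes a new state from its old state and the received messages. In the global mode a node may send at most $\gamma$ bits in total and receive at most $\gamma$ bits in total per round (all that a recipient learns is the received bit strings; a sender who wants to be known writes its identifier into the message). If nodes exceed this capacity, an adversary who knows all states and all coin flips selects which of the messages from or to these nodes are delivered, within the capacity. After $T$ rounds every node $v$ outputs a label $\lambda(v)\in\{0,1\}^*$ and a function: * *exact distance oracles:* $o_v$ with $o_v(\lambda(u))=d_G(u,v)$ for all nodes $u,v$; * *exact stateless routing schemes:* $\rho_v$ with $\rho_v(\lambda(u))\in N(v)\cup\{v\}$ and $\rho_v(\lambda(v))=v$, such that for all $u,v$ the sequence $v_0=v$, $v_{i+1}=\rho_{v_i}(\lambda(u))$ reaches $u$ along at most $d_G(v,u)$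 edges; * *exact stateful routing schemes:* the same, except that $\rho_v$ also reads and rewrites a packet header, which is a bit string of arbitrary length that is empty at the source. The algorithm has success probability $p$ with labels of at most $L$ bits if, on every connected unweighted graph with $n$ nodes, with probability at least $p$ the output is correct and all labels have at most $L$ bits, whatever the adversary does. **Theorem.** There is a constant $c>0$ such that for every $p>0$ there are $C>0$ and $n_0$ with the following property. Let $n\ge n_0$ and $\gamma\ge 1$ be integers. Any randomized $\mathsf{HYBRID}(\infty,\gamma)$ algorithm that, with success probability at least $p$ on connected unweighted graphs with $n$ nodes, computes within $T$ rounds exact distance oracles, exact stateless routing schemes, or exact stateful routing schemes with labels of at most $c\,n^{2/3}\gamma^{1/3}$ bits satisfies $$T\;\ge\; C\,\frac{n^{1/3}}{\gamma^{1/3}}.$$ -/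

import Mathlib

open MeasureTheory

/-- A randomized synchronous message passing algorithm with two communication modes on the node
set `Fin n` (a node is its identifier); `Ω` is the sample space of the coin flips and `Out` is the
type of what one node outputs. Nodes are computationally unbounded and have unbounded memory. -/
structure HybridAlgorithm (n : ℕ) (Ω Out : Type) where
  /-- Local states of a node. -/
  State : Type
  /-- The initial state: it depends on the coin flips, the node's own identifier and the set of its
  neighbours. The state may store any part of the coin flips, so coins used in later rounds and
  private coins (`Ω` a product of which node `v` reads the `v`-th factor) are covered. -/
  init : Ω → Fin n → Set (Fin n) → State
  /-- The message (of arbitrary length, or none) sent to a given neighbour in the local mode. -/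
  localMsg : State → Fin n → Option (List Bool)
  /-- The messages sent in the global mode, with their recipients. -/
  globalMsgs : State → Multiset (Fin n × List Bool)
  /-- The new state: it depends on the old one, on the local message received from each neighbour,
  and on the bit strings received in the global mode. -/
  next : State → (Fin n → Option (List Bool)) → Multiset (List Bool) → State
  /-- The output of a node whose final state is given. -/
  output : State → Out

/-- A message of the global mode, under way from `src` to `dst`. -/
structure Packet (n : ℕ) where
  src : Fin n
  dst : Fin n
  payload : List Bool

namespace Packet

variable {n : ℕ}

/-- Total size in bits of a collection of messages. -/
def totalSize (P : Multiset (Packet n)) : ℕ :=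
  (P.map fun q => q.payload.length).sum

/-- Number of bits that `v` sends. -/
def sentBits (P : Multiset (Packet n)) (v : Fin n) : ℕ :=
  totalSize (P.filter fun q => q.src = v)

/-- Number of bits that `v` receives. -/
def receivedBits (P : Multiset (Packet n)) (v : Fin n) : ℕ :=
  totalSize (P.filter fun q => q.dst = v)

/-- Given that the messages `S` are sent in the global mode with capacity `γ`, the messages `D` may
be the ones that are delivered. No node sends or receives more than `γ` delivered bits, and
messages whose sender and recipient both respect the capacity are delivered; which ones of the
other messages get through is up to the adversary. -/
def IsDelivery (γ : ℕ) (S D : Multiset (Packet n)) : Prop :=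
  D ≤ S ∧
  (∀ v, sentBits D v ≤ γ ∧ receivedBits D v ≤ γ) ∧
  (D.filter fun q => sentBits S q.src ≤ γ ∧ receivedBits S q.dst ≤ γ) =
    S.filter fun q => sentBits S q.src ≤ γ ∧ receivedBits S q.dst ≤ γ

/-- The bit strings that `v` receives in the global mode. -/
def inbox (D : Multiset (Packet n)) (v : Fin n) : Multiset (List Bool) :=
  (D.filter fun q => q.dst = v).map fun q => q.payload

end Packet

namespace HybridAlgorithm

variable {n : ℕ} {Ω Out : Type}

/-- All global messages sent when the nodes are in the states `s`. A message has at least one bit;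
the empty string is no message. -/
def sentGlobal (A : HybridAlgorithm n Ω Out) (s : Fin n → A.State) : Multiset (Packet n) :=
  ∑ v : Fin n, ((A.globalMsgs (s v)).filter fun m => m.2 ≠ []).map fun m => ⟨v, m.1, m.2⟩

open Classical in
/-- The local messages that `v` receives from its neighbours in `G`. -/
noncomputable def localInbox (A : HybridAlgorithm n Ω Out) (G : SimpleGraph (Fin n))
    (s : Fin n → A.State) (v : Fin n) : Fin n → Option (List Bool) :=
  fun u => if G.Adj u v then A.localMsg (s u) v else none

/-- `σ t v` is the state of node `v` after `t` rounds, in an execution of `T` rounds in the hybrid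
model with unbounded local messages and global capacity `γ`, with local graph `G` and coin flips
`ω`. The executions for given `G` and `ω` differ only in the choices of the adversary. -/
structure IsExecution (A : HybridAlgorithm n Ω Out) (γ : ℕ) (G : SimpleGraph (Fin n)) (ω : Ω)
    (T : ℕ) (σ : ℕ → Fin n → A.State) : Prop where
  start : ∀ v, σ 0 v = A.init ω v (G.neighborSet v)
  step : ∀ t < T, ∃ D, Packet.IsDelivery γ (A.sentGlobal (σ t)) D ∧
    ∀ v, σ (t + 1) v = A.next (σ t v) (A.localInbox G (σ t) v) (Packet.inbox D v)

/-- On `G`, with probability at least `p`, the outputs after `T` rounds satisfy `Good`, whatever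
the adversary does. The adversary knows all coin flips, so it is quantified after `ω`. -/
def SucceedsOn (A : HybridAlgorithm n Ω Out) [MeasurableSpace Ω] (μ : Measure Ω) (γ T : ℕ) (p : ℝ)
    (G : SimpleGraph (Fin n)) (Good : (Fin n → Out) → Prop) : Prop :=
  ∃ S : Set Ω, MeasurableSet S ∧ ENNReal.ofReal p ≤ μ S ∧
    ∀ ω ∈ S, ∀ σ, A.IsExecution γ G ω T σ → Good fun v => A.output (σ T v)

end HybridAlgorithm

/-- The nodes visited by a packet with destination label `l` that starts at `v` with an empty
header, and the header it carries there, when the routing function of each node maps the label and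
the current header to the next node and a new header. -/
def routingTrajectory {n : ℕ} (ρ : Fin n → List Bool → List Bool → Fin n × List Bool)
    (l : List Bool) (v : Fin n) : ℕ → Fin n × List Bool
  | 0 => (v, [])
  | i + 1 =>
    ρ (routingTrajectory ρ l v i).1 l (routingTrajectory ρ l v i).2

/-- The number of edges traversed by `x` in its first `h` steps. -/
def edgesTraversed {n : ℕ} (x : ℕ → Fin n) (h : ℕ) : ℕ :=
  ((Finset.range h).filter fun i => x i ≠ x (i + 1)).card

/-- Exact distance oracles on the unweighted graph `G`, with labels `lab v` and oracle functions
`o v`. -/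
def IsExactDistanceOracle {n : ℕ} (G : SimpleGraph (Fin n)) (lab : Fin n → List Bool)
    (o : Fin n → List Bool → ℕ) : Prop :=
  ∀ v u, o v (lab u) = G.dist u v

/-- Exact stateful routing schemes on the unweighted graph `G`, with labels `lab v` and routing
functions `ρ v`. -/
def IsExactStatefulRouting {n : ℕ} (G : SimpleGraph (Fin n)) (lab : Fin n → List Bool)
    (ρ : Fin n → List Bool → List Bool → Fin n × List Bool) : Prop :=
  (∀ v u hdr, (ρ v (lab u) hdr).1 = v ∨ G.Adj v (ρ v (lab u) hdr).1) ∧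
  (∀ v hdr, (ρ v (lab v) hdr).1 = v) ∧
  ∀ v u, ∃ h, (routingTrajectory ρ (lab u) v h).1 = u ∧
    edgesTraversed (fun i => (routingTrajectory ρ (lab u) v i).1) h ≤ G.dist v u

/-- Exact stateless routing schemes on the unweighted graph `G`, with labels `lab v` and routing
functions `ρ v`; the nodes visited by a packet from `v` to `u` are the iterates of
`x ↦ ρ x (lab u)`. -/
def IsExactStatelessRouting {n : ℕ} (G : SimpleGraph (Fin n)) (lab : Fin n → List Bool)
    (ρ : Fin n → List Bool → Fin n) : Prop :=
  (∀ v u, ρ v (lab u) = v ∨ G.Adj v (ρ v (lab u))) ∧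
  (∀ v, ρ v (lab v) = v) ∧
  ∀ v u, ∃ h, (fun x => ρ x (lab u))^[h] v = u ∧
    edgesTraversed (fun i => (fun x => ρ x (lab u))^[i] v) h ≤ G.dist v u

/-- The three problems. -/
inductive HybridTask where
  | distanceOracle
  | statelessRouting
  | statefulRouting

namespace HybridTask

/-- The functions that a node outputs besides its label. -/
def Fn (n : ℕ) : HybridTask → Type
  | distanceOracle => List Bool → ℕ
  | statelessRouting => List Bool → Fin n
  | statefulRouting => List Bool → List Bool → Fin n × List Bool

/-- The labels and functions solve the problem exactly on `G`. -/
def IsExact {n : ℕ} (G : SimpleGraph (Fin n)) (lab : Fin n → List Bool) :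
    (task : HybridTask) → (Fin n → task.Fn n) → Prop
  | distanceOracle => fun f => IsExactDistanceOracle G lab f
  | statelessRouting => fun f => IsExactStatelessRouting G lab f
  | statefulRouting => fun f => IsExactStatefulRouting G lab f

end HybridTask

/-- In `T` rounds of the hybrid model with unbounded local messages and global capacity `γ`, the
algorithm `A` solves the task exactly with labels of at most `L` bits, with success probability at
least `p` on every connected unweighted graph with `n` nodes. -/
def HybridAlgorithm.Computes {n : ℕ} {Ω : Type} (task : HybridTask)
    (A : HybridAlgorithm n Ω (List Bool × task.Fn n)) [MeasurableSpace Ω] (μ : Measure Ω)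
    (γ T : ℕ) (p L : ℝ) : Prop :=
  ∀ G : SimpleGraph (Fin n), G.Connected →
    A.SucceedsOn μ γ T p G fun out =>
      (∀ v, ((out v).1.length : ℝ) ≤ L) ∧
      task.IsExact G (fun v => (out v).1) (fun v => (out v).2)

/-! The graph hides `k * m` bits `x` in the edges between the near ends of `k` paths (rows) and `m`
joints. The far end of row `i.succ` is at distance `h + 2` from target `j` if `x i j` is true;
otherwise it is at distance `h + 3`, by a detour through row `0`. The first edge of a shortest route
differs as well. In all three tasks the function at the far end, applied to the label of the target,
therefore reveals the bit (`detects`, `not_detects`). If `T < h`, local messages carry nothing about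
`x` to the far ends (`state_eq_of_inbox_eq`). For fixed coins, `x` is thus determined by the global
strings that the row nodes receive and by the target labels (`IsGoodRun.eq`), so at most `2 ^ O(γ *
T * k * h + L * m)` inputs `x` can be solved (`card_le_of_isGoodRun`). Averaging over the coins
bounds `p * 2 ^ (k * m)` by this number. Take `h = T + 1`, with `k * h` and `m` of order `n`. If `T`
is small against the cube root of `n / γ`, then `k` exceeds `8 * L` and `m` exceeds `64 * γ * h ^
2`, which makes the exponent at most `k * m / 2`, a contradiction for large `n`. The label term
dictates the exponent `1 / 3`. -/

/-! ### Averaging over the coins -/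

/-- Double counting: the expected number of events that occur is at least `p` times their number,
and it is at most `B`. -/
theorem mul_card_le_of_forall_card_le {Ω ι : Type*} [Fintype ι] [MeasurableSpace Ω]
    (μ : Measure Ω) [IsProbabilityMeasure μ] (S : ι → Set Ω) (hS : ∀ i, MeasurableSet (S i))
    {p : ℝ} (hp : 0 ≤ p) (hμ : ∀ i, ENNReal.ofReal p ≤ μ (S i)) {B : ℕ}
    (hB : ∀ ω, ∀ F : Finset ι, (∀ i ∈ F, ω ∈ S i) → F.card ≤ B) :
    p * Fintype.card ι ≤ B := by
  classical
  have h1 : ∑ i, μ (S i) ≤ B := by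
    calc ∑ i, μ (S i) = ∑ i, ∫⁻ ω, (S i).indicator 1 ω ∂μ := by
          simp_rw [lintegral_indicator_one (hS _)]
      _ = ∫⁻ ω, ∑ i, (S i).indicator 1 ω ∂μ := by
          rw [lintegral_finsetSum]
          exact fun i _ => measurable_one.indicator (hS i)
      _ ≤ ∫⁻ _, (B : ENNReal) ∂μ := by
          refine lintegral_mono fun ω => ?_
          have h2 : ∑ i, (S i).indicator (1 : Ω → ENNReal) ω =
              ((Finset.univ.filter fun i => ω ∈ S i).card : ENNReal) := by
            simp [Set.indicator_apply]
          rw [h2]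
          exact Nat.cast_le.2 (hB ω _ fun i hi => (Finset.mem_filter.1 hi).2)
      _ = B := by simp
  have h3 : (Fintype.card ι : ENNReal) * ENNReal.ofReal p ≤ B := by
    refine le_trans ?_ h1
    simpa using Finset.card_nsmul_le_sum Finset.univ (fun i => μ (S i)) _ fun i _ => hμ i
  have h4 := ENNReal.toReal_mono (by simp) h3
  rw [ENNReal.toReal_mul, ENNReal.toReal_ofReal hp] at h4
  simpa [mul_comm] using h4

/-! ### Encoding received messages by a bounded number of symbols -/

/-- The entries of a list, as a function on the first `N` positions. -/
def List.entries {α : Type*} (N : ℕ) (l : List α) : Fin N → Option α := fun i => l[(i : ℕ)]?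

theorem List.entries_inj {α : Type*} {N : ℕ} {l l' : List α} (hl : l.length ≤ N)
    (hl' : l'.length ≤ N) (h : l.entries N = l'.entries N) : l = l' := by
  refine List.ext_getElem? fun i => ?_
  by_cases hi : i < N
  · exact congrFun h ⟨i, hi⟩
  · rw [List.getElem?_eq_none (by omega), List.getElem?_eq_none (by omega)]

/-- A list of bit strings written as one string, with `none` closing each of them. -/
def delimited : List (List Bool) → List (Option Bool)
  | [] => []
  | s :: l => s.map some ++ none :: delimited l

theorem delimited_injective : Function.Injective delimited := by
  intro l
  induction l with
  | nil => intro l' h; cases l' with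
    | nil => rfl
    | cons s l' => simp [delimited] at h
  | cons s l ih =>
    intro l' h
    cases l' with
    | nil => simp [delimited] at h
    | cons s' l' =>
      simp only [delimited] at h
      have key : ∀ (s s' : List Bool), s.map some ++ none :: delimited l =
          s'.map some ++ none :: delimited l' → s = s' ∧ l = l' := by
        intro s
        induction s with
        | nil => intro s' h; cases s' with
          | nil => exact ⟨rfl, ih (by simpa using h)⟩
          | cons b s' => simp at h
        | cons a s ihs => intro s' h; cases s' with
          | nil => simp at h
          | cons b s' =>
            simp only [List.map_cons, List.cons_append, List.cons.injEq, Option.some.injEq] at h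
            obtain ⟨h1, h2⟩ := ihs s' h.2
            exact ⟨by rw [h.1, h1], h2⟩
      obtain ⟨h1, h2⟩ := key s s' h
      rw [h1, h2]

/-- Each nonempty string pays for its own delimiter; empty strings would make the number of
delimiters unbounded. -/
theorem length_delimited_le (l : List (List Bool)) (hl : ∀ s ∈ l, s ≠ []) :
    (delimited l).length ≤ 2 * (l.map List.length).sum := by
  induction l with
  | nil => simp [delimited]
  | cons s l ih =>
    have h1 := ih fun s hs => hl s (List.mem_cons_of_mem _ hs)
    have h2 := List.length_pos_iff.2 (hl s List.mem_cons_self)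
    simp [delimited]
    omega

/-- A multiset of bit strings as a function on `2 * γ` positions. -/
noncomputable def inboxCode (γ : ℕ) (M : Multiset (List Bool)) :
    Fin (2 * γ) → Option (Option Bool) :=
  (delimited M.toList).entries (2 * γ)

theorem inboxCode_inj {γ : ℕ} {M M' : Multiset (List Bool)} (hM : ∀ s ∈ M, s ≠ [])
    (hM' : ∀ s ∈ M', s ≠ []) (hs : (M.map List.length).sum ≤ γ)
    (hs' : (M'.map List.length).sum ≤ γ) (h : inboxCode γ M = inboxCode γ M') : M = M' := by
  have key : ∀ M : Multiset (List Bool), (∀ s ∈ M, s ≠ []) → (M.map List.length).sum ≤ γ →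
      (delimited M.toList).length ≤ 2 * γ := by
    intro M h1 h2
    refine (length_delimited_le _ fun s hs => h1 s (Multiset.mem_toList.1 hs)).trans ?_
    have h3 : (M.toList.map List.length).sum = (M.map List.length).sum := by
      conv_rhs => rw [← Multiset.coe_toList M]
      rw [Multiset.map_coe, Multiset.sum_coe]
    omega
  have h4 := delimited_injective (List.entries_inj (key M hM hs) (key M' hM' hs') h)
  rw [← Multiset.coe_toList M, h4, Multiset.coe_toList]

/-! ### Existence of executions and locality -/

namespace Packet

variable {n : ℕ}

theorem totalSize_mono {P Q : Multiset (Packet n)} (h : P ≤ Q) : totalSize P ≤ totalSize Q := by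
  obtain ⟨R, rfl⟩ := Multiset.le_iff_exists_add.1 h
  simp [totalSize]

/-- The adversary may drop every message whose sender or recipient is overloaded. Success quantifies
over all executions, so it says something only because one exists. -/
theorem exists_isDelivery (γ : ℕ) (S : Multiset (Packet n)) : ∃ D, IsDelivery γ S D := by
  refine ⟨S.filter fun q => sentBits S q.src ≤ γ ∧ receivedBits S q.dst ≤ γ,
    Multiset.filter_le _ _, fun v => ⟨?_, ?_⟩, by simp [Multiset.filter_filter]⟩
  · by_cases hv : sentBits S v ≤ γ
    · exact (totalSize_mono (Multiset.filter_le_filter _ (Multiset.filter_le _ _))).trans hv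
    · rw [sentBits, Multiset.filter_filter, Multiset.filter_eq_nil.2]
      · simp [totalSize]
      · rintro q - ⟨rfl, h, -⟩
        exact hv h
  · by_cases hv : receivedBits S v ≤ γ
    · exact (totalSize_mono (Multiset.filter_le_filter _ (Multiset.filter_le _ _))).trans hv
    · rw [receivedBits, Multiset.filter_filter, Multiset.filter_eq_nil.2]
      · simp [totalSize]
      · rintro q - ⟨rfl, -, h⟩
        exact hv h

theorem IsDelivery.sum_length_inbox_le {γ : ℕ} {S D : Multiset (Packet n)}
    (h : IsDelivery γ S D) (v : Fin n) : ((inbox D v).map List.length).sum ≤ γ := by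
  have := (h.2.1 v).2
  simpa [receivedBits, totalSize, inbox, Function.comp_def] using this

end Packet

namespace HybridAlgorithm

variable {n : ℕ} {Ω Out : Type}

theorem payload_ne_nil {A : HybridAlgorithm n Ω Out} {s : Fin n → A.State} {q : Packet n}
    (hq : q ∈ A.sentGlobal s) : q.payload ≠ [] := by
  simp only [sentGlobal, Multiset.mem_sum, Multiset.mem_map, Multiset.mem_filter] at hq
  obtain ⟨v, -, m, hm, rfl⟩ := hq
  exact hm.2

theorem ne_nil_of_mem_inbox {A : HybridAlgorithm n Ω Out} {γ : ℕ} {s : Fin n → A.State}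
    {D : Multiset (Packet n)} (h : Packet.IsDelivery γ (A.sentGlobal s) D) {v : Fin n}
    {b : List Bool} (hb : b ∈ Packet.inbox D v) : b ≠ [] := by
  simp only [Packet.inbox, Multiset.mem_map, Multiset.mem_filter] at hb
  obtain ⟨q, hq, rfl⟩ := hb
  exact payload_ne_nil (Multiset.mem_of_le h.1 hq.1)

theorem exists_isExecution (A : HybridAlgorithm n Ω Out) (γ : ℕ) (G : SimpleGraph (Fin n)) (ω : Ω)
    (T : ℕ) : ∃ σ, A.IsExecution γ G ω T σ := by
  choose D hD using fun s => Packet.exists_isDelivery γ (A.sentGlobal s)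
  let σ : ℕ → Fin n → A.State := fun t => Nat.rec (fun v => A.init ω v (G.neighborSet v))
    (fun _ s v => A.next (s v) (A.localInbox G s v) (Packet.inbox (D s) v)) t
  exact ⟨σ, fun v => rfl, fun t _ => ⟨D (σ t), hD _, fun v => rfl⟩⟩

/-- A node at depth more than `t` cannot tell two graphs apart in `t` rounds if they differ only
at depth `0` and the nodes in between receive the same global messages. -/
theorem state_eq_of_inbox_eq (A : HybridAlgorithm n Ω Out) {G G' : SimpleGraph (Fin n)} {ω : Ω}
    {T : ℕ} {σ σ' : ℕ → Fin n → A.State} {I I' : ℕ → Fin n → Multiset (List Bool)}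
    (h0 : ∀ v, σ 0 v = A.init ω v (G.neighborSet v))
    (h0' : ∀ v, σ' 0 v = A.init ω v (G'.neighborSet v))
    (h1 : ∀ t < T, ∀ v, σ (t + 1) v = A.next (σ t v) (A.localInbox G (σ t) v) (I t v))
    (h1' : ∀ t < T, ∀ v, σ' (t + 1) v = A.next (σ' t v) (A.localInbox G' (σ' t) v) (I' t v))
    (depth : Fin n → ℕ) (hN : ∀ v, 0 < depth v → ∀ u, G.Adj u v ↔ G'.Adj u v)
    (hd : ∀ u v, G.Adj u v → depth v ≤ depth u + 1)
    (hI : ∀ t < T, ∀ v, 2 ≤ depth v → I t v = I' t v) :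
    ∀ t ≤ T, ∀ v, t < depth v → σ t v = σ' t v := by
  intro t
  induction t with
  | zero =>
    intro _ v hv
    have : G.neighborSet v = G'.neighborSet v := by
      ext u
      simpa [SimpleGraph.adj_comm] using hN v hv u
    rw [h0, h0', this]
  | succ t ih =>
    intro ht v hv
    -- Here `depth v` exceeds `t + 1`, so it is at least `2` and `hI` applies; the neighbours of `v`
    -- have depth more than `t`.
    rw [h1 t ht, h1' t ht, ih (by omega) v (by omega), hI t ht v (by omega)]
    congr 1
    funext u
    by_cases hu : G.Adj u v
    · have := hd u v hu
      simp only [localInbox, if_pos hu, if_pos ((hN v (by omega) u).1 hu)]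
      rw [ih (by omega) u (by omega)]
    · simp only [localInbox, if_neg hu, if_neg (mt (hN v (by omega) u).2 hu)]

end HybridAlgorithm

/-! ### What the function at one node reveals about distances -/

section Routing

variable {n : ℕ} {G : SimpleGraph (Fin n)}

theorem edgesTraversed_succ (x : ℕ → Fin n) (h : ℕ) :
    edgesTraversed x (h + 1) = edgesTraversed x h + if x h ≠ x (h + 1) then 1 else 0 := by
  rw [edgesTraversed, Finset.range_add_one, Finset.filter_insert]
  split_ifs with hx
  · rw [Finset.card_insert_of_notMem (by simp), edgesTraversed]
  · rfl

theorem edgesTraversed_add_dist_le (hG : G.Connected) {x : ℕ → Fin n}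
    (hx : ∀ i, x (i + 1) = x i ∨ G.Adj (x i) (x (i + 1))) {a h : ℕ} (hah : a ≤ h) :
    edgesTraversed x a + G.dist (x a) (x h) ≤ edgesTraversed x h := by
  induction h, hah using Nat.le_induction with
  | base => simp
  | succ h _ ih =>
    rw [edgesTraversed_succ]
    rcases hx h with hh | hh
    · rw [hh]; omega
    · rw [if_pos hh.ne]
      have h1 := hG.dist_triangle (u := x a) (v := x h) (w := x (h + 1))
      rw [SimpleGraph.dist_eq_one_iff_adj.2 hh] at h1
      omega

/-- A packet for label `l` that starts at `v` moves to `w` when it first leaves `v`. -/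
def LeavesTo (ρ : Fin n → List Bool → List Bool → Fin n × List Bool) (v : Fin n) (l : List Bool)
    (w : Fin n) : Prop :=
  ∃ i, (∀ j ≤ i, (routingTrajectory ρ l v j).1 = v) ∧ (routingTrajectory ρ l v (i + 1)).1 = w

/-- Until the packet first leaves `v`, only the function of `v` acts on it, even if it waits there
and rewrites its header. -/
theorem LeavesTo.of_eq {ρ ρ' : Fin n → List Bool → List Bool → Fin n × List Bool} {v w : Fin n}
    {l : List Bool} (hρ : ρ v = ρ' v) (h : LeavesTo ρ v l w) : LeavesTo ρ' v l w := by
  obtain ⟨i, hi, hw⟩ := h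
  have key : ∀ j ≤ i + 1, routingTrajectory ρ' l v j = routingTrajectory ρ l v j := by
    intro j
    induction j with
    | zero => intro _; rfl
    | succ j ih =>
      intro hj
      simp only [routingTrajectory]
      rw [ih (by omega), hi j (by omega), hρ]
  exact ⟨i, fun j hj => by rw [key j (by omega)]; exact hi j hj, by rw [key _ le_rfl]; exact hw⟩

theorem IsExactStatefulRouting.trajectory_step {lab : Fin n → List Bool}
    {ρ : Fin n → List Bool → List Bool → Fin n × List Bool}
    (h : IsExactStatefulRouting G lab ρ) (v u : Fin n) (i : ℕ) :
    (routingTrajectory ρ (lab u) v (i + 1)).1 = (routingTrajectory ρ (lab u) v i).1 ∨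
      G.Adj (routingTrajectory ρ (lab u) v i).1 (routingTrajectory ρ (lab u) v (i + 1)).1 :=
  h.1 _ u _

/-- The edge to `w` uses up one of the at most `G.dist v u` edges, and the rest of the route is no
shorter than `G.dist w u`. -/
theorem IsExactStatefulRouting.dist_add_one_le (hG : G.Connected) {lab : Fin n → List Bool}
    {ρ : Fin n → List Bool → List Bool → Fin n × List Bool}
    (h : IsExactStatefulRouting G lab ρ) {v u w : Fin n} (huv : u ≠ v) (hwv : w ≠ v)
    (hw : LeavesTo ρ v (lab u) w) : G.dist w u + 1 ≤ G.dist v u := by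
  obtain ⟨i, hi, rfl⟩ := hw
  obtain ⟨t, ht, hd⟩ := h.2.2 v u
  have hit : i + 1 ≤ t := by
    by_contra hcon
    exact huv (ht.symm.trans (hi t (by omega)))
  have h1 := edgesTraversed_add_dist_le hG
    (x := fun i => (routingTrajectory ρ (lab u) v i).1) (h.trajectory_step v u) hit
  have h2 := edgesTraversed_succ (fun i => (routingTrajectory ρ (lab u) v i).1) i
  rw [if_pos (by rw [hi i le_rfl]; exact hwv.symm)] at h2
  simp only [ht] at h1
  omega

theorem IsExactStatefulRouting.exists_leavesTo {lab : Fin n → List Bool}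
    {ρ : Fin n → List Bool → List Bool → Fin n × List Bool}
    (h : IsExactStatefulRouting G lab ρ) {v u : Fin n} (huv : u ≠ v) :
    ∃ w, G.Adj v w ∧ LeavesTo ρ v (lab u) w := by
  classical
  obtain ⟨t, ht, -⟩ := h.2.2 v u
  have hex : ∃ t, (routingTrajectory ρ (lab u) v t).1 ≠ v := ⟨t, by rwa [ht]⟩
  obtain ⟨i, hi⟩ : ∃ i, Nat.find hex = i + 1 := by
    refine Nat.exists_eq_succ_of_ne_zero fun h0 => ?_
    have := Nat.find_spec hex
    rw [h0] at this
    exact this rfl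
  have h1 : ∀ j ≤ i, (routingTrajectory ρ (lab u) v j).1 = v := fun j hj => by
    by_contra hcon
    have := Nat.find_min' hex hcon
    omega
  have h2 := Nat.find_spec hex
  rw [hi] at h2
  refine ⟨_, ?_, i, h1, rfl⟩
  have h3 := h.trajectory_step v u i
  rw [h1 i le_rfl] at h3
  exact h3.resolve_left h2

theorem routingTrajectory_stateless (ρ : Fin n → List Bool → Fin n) (l : List Bool) (v : Fin n)
    (i : ℕ) : (routingTrajectory (fun x l _ => (ρ x l, [])) l v i).1 = (fun x => ρ x l)^[i] v := by
  induction i with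
  | zero => rfl
  | succ i ih =>
    rw [Function.iterate_succ_apply', ← ih]
    rfl

theorem IsExactStatelessRouting.stateful {lab : Fin n → List Bool} {ρ : Fin n → List Bool → Fin n}
    (h : IsExactStatelessRouting G lab ρ) :
    IsExactStatefulRouting G lab fun x l _ => (ρ x l, []) := by
  refine ⟨fun v u _ => h.1 v u, fun v _ => h.2.1 v, fun v u => ?_⟩
  simp only [routingTrajectory_stateless]
  exact h.2.2 v u

/-- Node `v` with function `f` finds the node labelled `l` at distance `d`, or does not start a
route there with the neighbour `z`. -/
def HybridTask.Detects (d : ℕ) (v z : Fin n) (l : List Bool) : (task : HybridTask) → task.Fn n → Prop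
  | distanceOracle => fun o => o l = d
  | statelessRouting => fun ρ => ¬ LeavesTo (fun _ l _ => (ρ l, [])) v l z
  | statefulRouting => fun ρ => ¬ LeavesTo (fun _ => ρ) v l z

theorem HybridTask.IsExact.detects (hG : G.Connected) {task : HybridTask} {lab : Fin n → List Bool}
    {f : Fin n → task.Fn n} (h : task.IsExact G lab f) {d : ℕ} {v z u : Fin n} (huv : u ≠ v)
    (hzv : z ≠ v) (hv : G.dist v u = d) (hz : d ≤ G.dist z u) :
    task.Detects d v z (lab u) (f v) := by
  cases task with
  | distanceOracle => exact (h v u).trans (SimpleGraph.dist_comm.trans hv)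
  | statelessRouting =>
    intro hl
    have := (IsExactStatelessRouting.stateful h).dist_add_one_le hG huv hzv
      (LeavesTo.of_eq (by rfl) hl)
    omega
  | statefulRouting =>
    intro hl
    have := IsExactStatefulRouting.dist_add_one_le hG h huv hzv (LeavesTo.of_eq (by rfl) hl)
    omega

/-- Leaving through `y` would not bring the packet closer to `u`, so it must leave through `z`, the
only other neighbour. -/
theorem HybridTask.IsExact.not_detects (hG : G.Connected) {task : HybridTask}
    {lab : Fin n → List Bool} {f : Fin n → task.Fn n} (h : task.IsExact G lab f) {d : ℕ}
    {v z y u : Fin n} (huv : u ≠ v) (hyv : y ≠ v) (hN : ∀ w, G.Adj v w → w = y ∨ w = z)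
    (hv : G.dist v u = d + 1) (hy : d + 1 ≤ G.dist y u) :
    ¬ task.Detects d v z (lab u) (f v) := by
  have key : ∀ ρ, IsExactStatefulRouting G lab ρ → LeavesTo ρ v (lab u) z := by
    intro ρ hρ
    obtain ⟨w, hw, hl⟩ := hρ.exists_leavesTo huv
    rcases hN w hw with rfl | rfl
    · have := hρ.dist_add_one_le hG huv hyv hl
      omega
    · exact hl
  cases task with
  | distanceOracle =>
    intro hd
    have := (h v u).symm.trans hd
    rw [SimpleGraph.dist_comm] at this
    omega
  | statelessRouting =>
    exact not_not.2 (LeavesTo.of_eq (by rfl) (key _ (IsExactStatelessRouting.stateful h)))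
  | statefulRouting => exact not_not.2 (LeavesTo.of_eq (by rfl) (key _ h))

end Routing

/-! ### The lower bound graph and its distances -/

/-- `k + 1` rows of `h + 1` nodes, `m` joints, `m` targets and `r` spare nodes. -/
abbrev Node (k h m r : ℕ) : Type :=
  (Fin (k + 1) × Fin (h + 1)) ⊕ (Fin m ⊕ (Fin m ⊕ Fin r))

namespace Node

variable {k h m r : ℕ}

abbrev row (i : Fin (k + 1)) (s : Fin (h + 1)) : Node k h m r := Sum.inl (i, s)
abbrev joint (j : Fin m) : Node k h m r := Sum.inr (Sum.inl j)
abbrev target (j : Fin m) : Node k h m r := Sum.inr (Sum.inr (Sum.inl j))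
abbrev spare (a : Fin r) : Node k h m r := Sum.inr (Sum.inr (Sum.inr a))

/-- The edges, in one orientation. Each row is a path. The far end of row `0` is adjacent to the
far ends of the other rows, its near end to all joints; the near end of row `i + 1` is adjacent to
the joint `j` if and only if `x i j`; every joint has a target of its own. -/
def Edge (x : Fin k → Fin m → Bool) : Node k h m r → Node k h m r → Prop
  | .inl (i, s), .inl (i', s') =>
      (i = i' ∧ s'.val = s.val + 1) ∨ (i = 0 ∧ s.val = h ∧ s'.val = h)
  | .inl (i, s), .inr (.inl j) => s.val = 0 ∧ ∀ i', i = Fin.succ i' → x i' j = true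
  | .inl (i, s), .inr (.inr (.inr _)) => i = 0 ∧ s.val = 0
  | .inr (.inl j), .inr (.inr (.inl j')) => j = j'
  | _, _ => False

/-- The distance from the part of the graph that depends on `x`. -/
def depth : Node k h m r → ℕ
  | .inl (_, s) => s.val
  | .inr (.inr (.inl _)) => 1
  | _ => 0

theorem edge_iff_of_depth_pos (x x' : Fin k → Fin m → Bool) (a b : Node k h m r)
    (hab : 0 < a.depth ∨ 0 < b.depth) : Edge x a b ↔ Edge x' a b := by
  rcases a with ⟨i, s⟩ | j | j | a <;> rcases b with ⟨i', s'⟩ | j' | j' | a' <;>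
    simp only [Edge, depth] at *
  constructor <;> rintro ⟨h1, -⟩ <;> omega

theorem depth_le_of_edge {x : Fin k → Fin m → Bool} {a b : Node k h m r} (hab : Edge x a b) :
    a.depth ≤ b.depth + 1 ∧ b.depth ≤ a.depth + 1 := by
  rcases a with ⟨i, s⟩ | j | j | a <;> rcases b with ⟨i', s'⟩ | j' | j' | a' <;>
    simp only [Edge, depth] at * <;> omega

variable {n : ℕ}

/-- The graph with the edges `Edge x`, with the nodes numbered by `e`. -/
def graph (e : Node k h m r ≃ Fin n) (x : Fin k → Fin m → Bool) : SimpleGraph (Fin n) :=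
  SimpleGraph.fromRel fun a b => Edge x (e.symm a) (e.symm b)

section

variable (e : Node k h m r ≃ Fin n) (x : Fin k → Fin m → Bool)

theorem graph_adj (a b : Fin n) : (graph e x).Adj a b ↔
    a ≠ b ∧ (Edge x (e.symm a) (e.symm b) ∨ Edge x (e.symm b) (e.symm a)) :=
  SimpleGraph.fromRel_adj _ _ _

theorem graph_adj_of_edge {a b : Node k h m r} (hab : Edge x a b) (hne : a ≠ b) :
    (graph e x).Adj (e a) (e b) := by
  rw [graph_adj]
  exact ⟨e.injective.ne hne, Or.inl (by simpa using hab)⟩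

theorem exists_walk_row (i : Fin (k + 1)) (s : ℕ) (hs : s < h + 1) :
    ∃ w : (graph e x).Walk (e (row i ⟨s, hs⟩)) (e (row i 0)), w.length = s := by
  induction s with
  | zero => exact ⟨.nil, rfl⟩
  | succ s ih =>
    obtain ⟨w, hw⟩ := ih (by omega)
    have hadj : (graph e x).Adj (e (row i ⟨s, by omega⟩)) (e (row i ⟨s + 1, hs⟩)) :=
      graph_adj_of_edge e x (by simp [Edge]) (by simp)
    exact ⟨.cons hadj.symm w, by simp [hw]⟩

theorem adj_joint_target (j : Fin m) : (graph e x).Adj (e (joint j)) (e (target j)) :=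
  graph_adj_of_edge e x (by simp [Edge]) (by simp)

theorem adj_hub_joint (j : Fin m) : (graph e x).Adj (e (row 0 0)) (e (joint j)) :=
  graph_adj_of_edge e x ⟨by simp, fun i hi => absurd hi.symm (Fin.succ_ne_zero i)⟩ (by simp)

theorem adj_row_joint {i : Fin k} {j : Fin m} (hx : x i j = true) :
    (graph e x).Adj (e (row i.succ 0)) (e (joint j)) :=
  graph_adj_of_edge e x ⟨by simp, fun i' hi => by rwa [← Fin.succ_injective _ hi]⟩ (by simp)

theorem adj_last (i : Fin k) :
    (graph e x).Adj (e (row 0 (Fin.last h))) (e (row i.succ (Fin.last h))) :=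
  graph_adj_of_edge e x (by simp [Edge]) (by simp [Fin.ext_iff])

theorem connected_graph : (graph e x).Connected := by
  have hrow : ∀ i s, (graph e x).Reachable (e (row i s)) (e (row i 0)) := fun i s =>
    (exists_walk_row e x i s.1 s.2).choose.reachable
  have key : ∀ a, (graph e x).Reachable (e a) (e (row 0 0)) := by
    rintro (⟨i, s⟩ | j | j | a)
    · refine Fin.cases (hrow 0 s) (fun i => ?_) i
      exact (hrow _ s).trans ((hrow _ (Fin.last h)).symm.trans
        ((adj_last e x i).symm.reachable.trans (hrow _ _)))
    · exact (adj_hub_joint e x j).symm.reachable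
    · exact (adj_joint_target e x j).symm.reachable.trans (adj_hub_joint e x j).symm.reachable
    · exact (graph_adj_of_edge (a := row 0 0) (b := spare a) e x (by simp [Edge])
        (by simp)).symm.reachable
  rw [SimpleGraph.connected_iff_exists_forall_reachable]
  exact ⟨e (row 0 0), fun w => by simpa using (key (e.symm w)).symm⟩

/-- A function that changes by at most one along each edge bounds distances from below; it is
applied to `height` and `farHeight`. -/
theorem le_add_dist (f : Node k h m r → ℕ)
    (hf : ∀ a b, Edge x a b → f a ≤ f b + 1 ∧ f b ≤ f a + 1) (a b : Node k h m r) :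
    f a ≤ f b + (graph e x).dist (e a) (e b) := by
  have key : ∀ a b (w : (graph e x).Walk a b), f (e.symm a) ≤ f (e.symm b) + w.length := by
    intro a b w
    induction w with
    | nil => simp
    | @cons u v _ huv w ih =>
      rw [graph_adj] at huv
      have h1 : f (e.symm u) ≤ f (e.symm v) + 1 := by
        rcases huv.2 with h | h
        · exact (hf _ _ h).1
        · exact (hf _ _ h).2
      rw [SimpleGraph.Walk.length_cons]
      omega
  obtain ⟨w, hw⟩ := (connected_graph e x).exists_walk_length_eq_dist (e a) (e b)
  simpa [hw] using key _ _ w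

theorem adj_iff_of_depth_pos (x' : Fin k → Fin m → Bool) {v : Fin n}
    (hv : 0 < (e.symm v).depth) (u : Fin n) : (graph e x).Adj u v ↔ (graph e x').Adj u v := by
  rw [graph_adj, graph_adj, edge_iff_of_depth_pos x x' _ _ (Or.inr hv),
    edge_iff_of_depth_pos x x' _ _ (Or.inl hv)]

theorem depth_le_of_adj {u v : Fin n} (huv : (graph e x).Adj u v) :
    (e.symm v).depth ≤ (e.symm u).depth + 1 := by
  rw [graph_adj] at huv
  rcases huv.2 with h | h
  · exact (depth_le_of_edge h).2
  · exact (depth_le_of_edge h).1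

/-- A lower bound for the distance to every target from a row node. -/
def height : Node k h m r → ℕ
  | .inl (_, s) => s.val + 2
  | .inr (.inr (.inl _)) => 0
  | .inr (.inl _) => 1
  | _ => 2

theorem le_dist_target (i : Fin (k + 1)) (j : Fin m) :
    h + 2 ≤ (graph e x).dist (e (row i (Fin.last h))) (e (target j)) := by
  have := le_add_dist e x height (fun a b hab => by
    rcases a with ⟨i, s⟩ | j | j | a <;> rcases b with ⟨i', s'⟩ | j' | j' | a' <;>
      simp only [Edge, height] at * <;> omega) (row i (Fin.last h)) (target j)
  simpa [height] using this

theorem dist_target_of_eq_true {i : Fin k} {j : Fin m} (hx : x i j = true) :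
    (graph e x).dist (e (row i.succ (Fin.last h))) (e (target j)) = h + 2 := by
  refine le_antisymm ?_ (le_dist_target e x _ j)
  obtain ⟨w, hw⟩ := exists_walk_row e x i.succ h (by omega)
  refine (SimpleGraph.dist_le (w.append
    (.cons (adj_row_joint e x hx) (.cons (adj_joint_target e x j) .nil)))).trans ?_
  simp [hw]

/-- A lower bound for the distance to the target `j` if row `i` is not adjacent to the joint. -/
def farHeight (i : Fin (k + 1)) (j : Fin m) : Node k h m r → ℕ
  | .inl (i', s) => if i' = i then min (s.val + 4) (h + 3) else s.val + 2
  | .inr (.inr (.inl j')) => if j' = j then 0 else 2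
  | .inr (.inl j') => if j' = j then 1 else 3
  | _ => 2

/-- Row `i.succ` can be left only through a joint other than `j`, of value `3`, or through the far
end of row `0`, of value `h + 2`. This permits the value `4` at the near end and the cap `h + 3`. -/
theorem farHeight_edge (hh : 0 < h) {i : Fin k} {j : Fin m} (hx : x i j = false)
    {a b : Node k h m r} (hab : Edge x a b) : farHeight i.succ j a ≤ farHeight i.succ j b + 1 ∧
      farHeight i.succ j b ≤ farHeight i.succ j a + 1 := by
  have h0 : (0 : Fin (k + 1)) ≠ i.succ := (Fin.succ_ne_zero i).symm
  rcases a with ⟨i, s⟩ | j | j | a <;> rcases b with ⟨i', s'⟩ | j' | j' | a' <;>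
    simp only [Edge, farHeight] at *
  · rcases hab with ⟨rfl, hs⟩ | ⟨rfl, hs, hs'⟩
    · split_ifs <;> omega
    · rw [if_neg h0]
      split_ifs <;> omega
  · split_ifs with h1 h2
    · subst h2
      rw [hab.2 _ h1] at hx
      cases hx
    all_goals omega
  · rw [if_neg (by rw [hab.1]; exact h0)]
    omega
  · subst hab
    split_ifs <;> omega

/-- The cap `h + 3` is reached at the far end and also one node before it, so a step back along the
row brings no gain. -/
theorem le_dist_target_of_eq_false (hh : 0 < h) {i : Fin k} {j : Fin m} (hx : x i j = false)
    (s : Fin (h + 1)) (hs : h ≤ s.val + 1) :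
    h + 3 ≤ (graph e x).dist (e (row i.succ s)) (e (target j)) := by
  have := le_add_dist e x (farHeight i.succ j) (fun a b => farHeight_edge x hh hx)
    (row i.succ s) (target j)
  simp only [farHeight, if_true] at this
  omega

theorem dist_target_of_eq_false (hh : 0 < h) {i : Fin k} {j : Fin m} (hx : x i j = false) :
    (graph e x).dist (e (row i.succ (Fin.last h))) (e (target j)) = h + 3 := by
  refine le_antisymm ?_ (le_dist_target_of_eq_false e x hh hx _ (by simp))
  obtain ⟨w, hw⟩ := exists_walk_row e x 0 h (by omega)
  refine (SimpleGraph.dist_le (SimpleGraph.Walk.cons (adj_last e x i).symm (w.append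
    (.cons (adj_hub_joint e x j) (.cons (adj_joint_target e x j) .nil))))).trans ?_
  simp [hw]

theorem eq_of_adj_last (hh : 0 < h) {i : Fin k} {w : Fin n}
    (hw : (graph e x).Adj (e (row i.succ (Fin.last h))) w) :
    w = e (row i.succ ⟨h - 1, by omega⟩) ∨ w = e (row 0 (Fin.last h)) := by
  rw [graph_adj, Equiv.symm_apply_apply] at hw
  rw [← Equiv.symm_apply_eq, ← Equiv.symm_apply_eq]
  obtain ⟨-, hw⟩ := hw
  generalize e.symm w = b at hw
  have h0 := Fin.succ_ne_zero i
  rcases b with ⟨i', s⟩ | j | j | a <;>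
    simp only [Edge, Fin.val_last, h0, false_and, or_false, hh.ne', and_false] at hw
  · have hs := s.2
    rcases hw with hw | ⟨rfl, hs⟩ | ⟨rfl, hs, -⟩
    · omega
    · left; congr; ext; simp; omega
    · right; congr; ext; simp [hs]

end

end Node

/-! ### Counting the inputs solved with fixed coins -/

namespace Node

variable {k h m r n : ℕ} {Ω : Type} {task : HybridTask}

/-- A run of an algorithm on `graph e x` that solves the task, with the strings received in the
global mode made explicit. -/
structure IsGoodRun (A : HybridAlgorithm n Ω (List Bool × task.Fn n)) (γ T : ℕ) (L : ℝ)
    (e : Node k h m r ≃ Fin n) (ω : Ω) (x : Fin k → Fin m → Bool) (σ : ℕ → Fin n → A.State)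
    (I : ℕ → Fin n → Multiset (List Bool)) : Prop where
  start : ∀ v, σ 0 v = A.init ω v ((graph e x).neighborSet v)
  step : ∀ t < T, ∀ v, σ (t + 1) v = A.next (σ t v) (A.localInbox (graph e x) (σ t) v) (I t v)
  ne_nil : ∀ t < T, ∀ v, ∀ s ∈ I t v, s ≠ []
  size_le : ∀ t < T, ∀ v, ((I t v).map List.length).sum ≤ γ
  length_le : ∀ v, ((A.output (σ T v)).1.length : ℝ) ≤ L
  exact : task.IsExact (graph e x) (fun v => (A.output (σ T v)).1) fun v => (A.output (σ T v)).2

section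

variable {A : HybridAlgorithm n Ω (List Bool × task.Fn n)} {γ T : ℕ} {L : ℝ}
  {e : Node k h m r ≃ Fin n} {ω : Ω}

theorem exists_isGoodRun {x : Fin k → Fin m → Bool}
    (hx : ∀ σ, A.IsExecution γ (graph e x) ω T σ →
      (∀ v, ((A.output (σ T v)).1.length : ℝ) ≤ L) ∧
      task.IsExact (graph e x) (fun v => (A.output (σ T v)).1) fun v => (A.output (σ T v)).2) :
    ∃ σ I, IsGoodRun A γ T L e ω x σ I := by
  obtain ⟨σ, hσ⟩ := A.exists_isExecution γ (graph e x) ω T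
  choose! D hD hstep using hσ.step
  exact ⟨σ, fun t v => Packet.inbox (D t) v, hσ.start, hstep,
    fun t ht v s hs => HybridAlgorithm.ne_nil_of_mem_inbox (hD t ht) hs,
    fun t ht v => (hD t ht).sum_length_inbox_le v, (hx σ hσ).1, (hx σ hσ).2⟩

variable {x x' : Fin k → Fin m → Bool} {σ σ' : ℕ → Fin n → A.State}
  {I I' : ℕ → Fin n → Multiset (List Bool)}

/-- Only inboxes at depth at least `2` matter, and such nodes lie in rows; those of joints, targets
and spare nodes need not be compared. -/
theorem IsGoodRun.state_eq (hr : IsGoodRun A γ T L e ω x σ I)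
    (hr' : IsGoodRun A γ T L e ω x' σ' I')
    (hI : ∀ t < T, ∀ i s, I t (e (row i s)) = I' t (e (row i s))) {a : Node k h m r}
    (ha : T < a.depth) : σ T (e a) = σ' T (e a) := by
  refine A.state_eq_of_inbox_eq hr.start hr'.start hr.step hr'.step (fun v => (e.symm v).depth)
    (fun v hv u => adj_iff_of_depth_pos e x x' hv u) (fun u v => depth_le_of_adj e x)
    (fun t ht v hv => ?_) T le_rfl (e a) (by simpa using ha)
  obtain ⟨b, rfl⟩ := e.surjective v
  rw [Equiv.symm_apply_apply] at hv
  rcases b with ⟨i, s⟩ | j | j | c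
  · exact hI t ht i s
  all_goals simp [depth] at hv

/-- The far end of row `i.succ` has the same function in both runs and the target has the same
label, so both runs read the same bit. -/
theorem IsGoodRun.apply_eq_true (hr : IsGoodRun A γ T L e ω x σ I)
    (hr' : IsGoodRun A γ T L e ω x' σ' I') (hT : T < h)
    (hI : ∀ t < T, ∀ i s, I t (e (row i s)) = I' t (e (row i s)))
    (hlab : ∀ j, (A.output (σ T (e (target j)))).1 = (A.output (σ' T (e (target j)))).1)
    {i : Fin k} {j : Fin m} (hx : x i j = true) : x' i j = true := by
  by_contra hx'
  rw [Bool.not_eq_true] at hx'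
  have hne : ∀ a b : Node k h m r, a ≠ b → e a ≠ e b := fun a b => e.injective.ne
  have h0 := Fin.succ_ne_zero i
  have h1 := hr.exact.detects (connected_graph e x) (hne (target j) (row i.succ (Fin.last h))
    (by simp)) (hne (row 0 (Fin.last h)) _ (by simp [h0.symm]))
    (dist_target_of_eq_true e x hx) (le_dist_target e x 0 j)
  refine hr'.exact.not_detects (connected_graph e x') (hne (target j) (row i.succ (Fin.last h))
    (by simp)) (hne (row i.succ ⟨h - 1, by omega⟩) _ (by simp [Fin.ext_iff]; omega))
    (fun w => eq_of_adj_last e x' (by omega))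
    (dist_target_of_eq_false e x' (by omega) hx')
    (le_dist_target_of_eq_false e x' (by omega) hx' _ (by simp; omega)) ?_
  rw [← hlab j, ← hr.state_eq hr' hI (a := row i.succ (Fin.last h)) (by simpa [depth] using hT)]
  exact h1

theorem IsGoodRun.eq (hr : IsGoodRun A γ T L e ω x σ I)
    (hr' : IsGoodRun A γ T L e ω x' σ' I') (hT : T < h)
    (hI : ∀ t < T, ∀ i s, I t (e (row i s)) = I' t (e (row i s)))
    (hlab : ∀ j, (A.output (σ T (e (target j)))).1 = (A.output (σ' T (e (target j)))).1) :
    x = x' := by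
  funext i j
  rw [Bool.eq_iff_iff]
  exact ⟨hr.apply_eq_true hr' hT hI hlab, hr'.apply_eq_true hr hT
    (fun t ht i s => (hI t ht i s).symm) fun j => (hlab j).symm⟩

theorem card_le_of_isGoodRun (hT : T < h) (F : Finset (Fin k → Fin m → Bool))
    (hF : ∀ x ∈ F, ∃ σ I, IsGoodRun A γ T L e ω x σ I) :
    F.card ≤ (4 ^ (2 * γ)) ^ (T * ((k + 1) * (h + 1))) * (3 ^ ⌊L⌋₊) ^ m := by
  choose σ I hr using fun x : F => hF x x.2
  -- An inbox takes `2 * γ` symbols from four (two bits, delimiter, padding), a label `⌊L⌋₊` symbols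
  -- from three.
  let code : F → (Fin T × (Fin (k + 1) × Fin (h + 1)) → Fin (2 * γ) → Option (Option Bool)) ×
      (Fin m → Fin ⌊L⌋₊ → Option Bool) := fun x =>
    (fun q => inboxCode γ (I x q.1 (e (row q.2.1 q.2.2))),
      fun j => (A.output (σ x T (e (target j)))).1.entries ⌊L⌋₊)
  have hcode : Function.Injective code := by
    intro x x' hxx
    refine Subtype.ext ((hr x).eq (hr x') hT (fun t ht i s => ?_) fun j => ?_)
    · exact inboxCode_inj ((hr x).ne_nil t ht _) ((hr x').ne_nil t ht _) ((hr x).size_le t ht _)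
        ((hr x').size_le t ht _) (congrFun (congrArg Prod.fst hxx) (⟨t, ht⟩, (i, s)))
    · exact List.entries_inj (Nat.le_floor ((hr x).length_le _))
        (Nat.le_floor ((hr x').length_le _)) (congrFun (congrArg Prod.snd hxx) j)
  have := Fintype.card_le_of_injective code hcode
  simpa [Fintype.card_option] using this

/-- Targets have depth `1`, so before any communication their labels are independent of `x` too, and
label length plays no role. This settles `T = 0`, where `γ` and hence the permitted labels may be
huge compared with `n`. -/
theorem card_le_one_of_isGoodRun {e : Node k 1 m r ≃ Fin n} (F : Finset (Fin k → Fin m → Bool))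
    (hF : ∀ x ∈ F, ∃ σ I, IsGoodRun A γ 0 L e ω x σ I) : F.card ≤ 1 := by
  refine Finset.card_le_one.2 fun x hx x' hx' => ?_
  obtain ⟨σ, I, hr⟩ := hF x hx
  obtain ⟨σ', I', hr'⟩ := hF x' hx'
  refine hr.eq hr' one_pos (fun t ht => absurd ht (Nat.not_lt_zero t)) fun j => ?_
  rw [hr.state_eq hr' (fun t ht => absurd ht (Nat.not_lt_zero t)) (by simp [depth])]

end

theorem mul_two_pow_le {A : HybridAlgorithm n Ω (List Bool × task.Fn n)} [MeasurableSpace Ω]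
    {μ : Measure Ω} [IsProbabilityMeasure μ] {γ T : ℕ} {p L : ℝ} (hp : 0 ≤ p)
    (hA : A.Computes task μ γ T p L) (e : Node k h m r ≃ Fin n) {B : ℕ}
    (hB : ∀ ω, ∀ F : Finset (Fin k → Fin m → Bool),
      (∀ x ∈ F, ∃ σ I, IsGoodRun A γ T L e ω x σ I) → F.card ≤ B) :
    p * 2 ^ (k * m) ≤ B := by
  choose S hS hp' hgood using fun x => hA (graph e x) (connected_graph e x)
  have := mul_card_le_of_forall_card_le μ S hS hp hp' fun ω F hF =>
    hB ω F fun x hx => exists_isGoodRun (hgood x ω (hF x hx))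
  rw [mul_comm k m, pow_mul]
  simpa using this

theorem exists_equiv (hn : (k + 1) * (h + 1) + 2 * m ≤ n) :
    ∃ r, Nonempty (Node k h m r ≃ Fin n) := by
  refine ⟨n - ((k + 1) * (h + 1) + 2 * m), ⟨Fintype.equivFinOfCardEq ?_⟩⟩
  simp
  omega

end Node

/-! ### Choice of parameters -/

namespace HybridAlgorithm.Computes

variable {n : ℕ} {Ω : Type} {task : HybridTask} {A : HybridAlgorithm n Ω (List Bool × task.Fn n)}
  [MeasurableSpace Ω] {μ : Measure Ω} [IsProbabilityMeasure μ] {γ T : ℕ} {p L : ℝ}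

theorem mul_two_pow_le (hp : 0 ≤ p) (hA : A.Computes task μ γ T p L) {k h m : ℕ} (hT : T < h)
    (hn : (k + 1) * (h + 1) + 2 * m ≤ n) :
    p * 2 ^ (k * m) ≤ 2 ^ (4 * γ * (T * ((k + 1) * (h + 1))) + 2 * ⌊L⌋₊ * m) := by
  obtain ⟨r, ⟨e⟩⟩ := Node.exists_equiv hn
  refine (Node.mul_two_pow_le hp hA e fun ω F => Node.card_le_of_isGoodRun hT F).trans ?_
  push_cast
  rw [pow_add]
  have h1 : ((4 : ℝ) ^ (2 * γ)) ^ (T * ((k + 1) * (h + 1))) =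
      2 ^ (4 * γ * (T * ((k + 1) * (h + 1)))) := by
    rw [show (4 : ℝ) = 2 ^ 2 by norm_num, ← pow_mul, ← pow_mul]
    congr 1
    ring
  have h2 : ((3 : ℝ) ^ ⌊L⌋₊) ^ m ≤ 2 ^ (2 * ⌊L⌋₊ * m) := by
    rw [pow_mul, pow_mul]
    gcongr
    norm_num
  rw [h1]
  gcongr

theorem mul_two_pow_le_one (hp : 0 ≤ p) (hA : A.Computes task μ γ 0 p L) {m : ℕ}
    (hn : 4 + 2 * m ≤ n) : p * 2 ^ m ≤ 1 := by
  obtain ⟨r, ⟨e⟩⟩ := Node.exists_equiv (k := 1) (h := 1) (m := m) (by simpa using hn)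
  simpa using Node.mul_two_pow_le hp hA e fun ω F => Node.card_le_one_of_isGoodRun F

end HybridAlgorithm.Computes

/-- The lower bound in terms of the cube roots `a` of `n` and `g` of `γ`. -/
theorem HybridAlgorithm.Computes.cubeRoot_le {n : ℕ} {Ω : Type} {task : HybridTask}
    {A : HybridAlgorithm n Ω (List Bool × task.Fn n)} [MeasurableSpace Ω] {μ : Measure Ω}
    [IsProbabilityMeasure μ] {γ T : ℕ} {p a g : ℝ} (hp : 0 < p) {N : ℕ} (hN : 1 < p * 2 ^ N)
    (hn : 16 * N + 8 ≤ n) (ha0 : 0 ≤ a) (ha : a ^ 3 = n) (hg1 : 1 ≤ g) (hg : g ^ 3 = γ)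
    (hA : A.Computes task μ γ T p (1 / 16 * a ^ 2 * g)) : a ≤ 16 * (T * g) := by
  by_contra! hlt
  rcases Nat.eq_zero_or_pos T with rfl | hT
  · have := hA.mul_two_pow_le_one hp.le (m := N) (by omega)
    linarith
  set L : ℝ := 1 / 16 * a ^ 2 * g with hL
  have hL0 : 0 ≤ L := by positivity
  have hT1 : (1 : ℝ) ≤ T := by exact_mod_cast hT
  set h := T + 1 with hh
  -- The rows take at most `4 * k * h ≤ n / 2` nodes, the joints and targets at most `n / 2`.
  set k := n / (8 * h) with hk
  set m := n / 4 with hm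
  have hhR : (h : ℝ) ≤ 2 * T := by rw [hh]; push_cast; linarith
  have hh0 : (0 : ℝ) < h := by positivity
  have hhg : (h : ℝ) * g ≤ a / 8 := by nlinarith
  have hga : g ≤ a / 16 := by nlinarith
  have hha : (h : ℝ) ≤ a / 8 := by nlinarith
  have hmR : (n : ℝ) / 8 ≤ m := by
    have h1 : n ≤ 8 * m := by omega
    have h2 : (n : ℝ) ≤ 8 * m := by exact_mod_cast h1
    linarith
  -- This keeps the global messages within a quarter of the `k * m` bits.
  have hγ : 64 * (γ * h ^ 2) ≤ m := by
    have h1 : ((h : ℝ) * g) ^ 2 ≤ (a / 8) ^ 2 := by gcongr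
    have h2 : (64 : ℝ) * (γ * h ^ 2) ≤ n / 8 := by
      calc (64 : ℝ) * (γ * h ^ 2) = 64 * (g * ((h : ℝ) * g) ^ 2) := by rw [← hg]; ring
        _ ≤ 64 * (a / 16 * (a / 8) ^ 2) := by gcongr
        _ = a ^ 3 / 16 := by ring
        _ ≤ n / 8 := by rw [ha]; linarith [(Nat.cast_nonneg n : (0 : ℝ) ≤ n)]
    exact_mod_cast h2.trans hmR
  have ha16 : 16 ≤ a := by linarith
  have hkR : a ^ 2 * g / 2 ≤ k := by
    have h1 : n < 8 * h * (k + 1) := Nat.lt_mul_div_succ n (by omega)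
    have h2 : (n : ℝ) < 8 * h * (k + 1) := by exact_mod_cast h1
    have h3 : (16 : ℝ) * h ≤ n := by
      rw [← ha]
      nlinarith [mul_nonneg ha0 (sub_nonneg.2 ha16)]
    have h4 : (n : ℝ) < 16 * h * k := by linarith
    have h5 : h * (a ^ 2 * g) ≤ a ^ 3 / 8 := by
      calc h * (a ^ 2 * g) = a ^ 2 * (h * g) := by ring
        _ ≤ a ^ 2 * (a / 8) := by gcongr
        _ = a ^ 3 / 8 := by ring
    rw [ha] at h5
    refine le_of_mul_le_mul_left ?_ hh0
    linarith
  -- This keeps the labels within another quarter.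
  have hLk : 8 * ⌊L⌋₊ ≤ k := by
    have h1 : (8 : ℝ) * ⌊L⌋₊ ≤ k := by
      have := Nat.floor_le hL0
      rw [hL] at this ⊢
      linarith
    exact_mod_cast h1
  have hk1 : 1 ≤ k := by
    have h1 : (0 : ℝ) < k := by
      refine lt_of_lt_of_le ?_ hkR
      have : 0 < a := by linarith
      positivity
    exact_mod_cast h1
  have hkh : k * (8 * h) ≤ n := Nat.div_mul_le_self _ _
  have hkh2 : (k + 1) * (h + 1) ≤ 2 * k * (2 * h) := Nat.mul_le_mul (by omega) (by omega)
  have hmain := hA.mul_two_pow_le hp.le (k := k) (h := h) (m := m) (by omega) (by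
    have : 2 * k * (2 * h) * 2 = k * (8 * h) := by ring
    omega)
  set E := 4 * γ * (T * ((k + 1) * (h + 1))) + 2 * ⌊L⌋₊ * m with hE
  have hE1 : 4 * (4 * γ * (T * ((k + 1) * (h + 1)))) ≤ k * m := by
    calc 4 * (4 * γ * (T * ((k + 1) * (h + 1))))
        ≤ 4 * (4 * γ * (h * (2 * k * (2 * h)))) := by gcongr; omega
      _ = k * (64 * (γ * h ^ 2)) := by ring
      _ ≤ k * m := by gcongr
  have hE2 : 4 * (2 * ⌊L⌋₊ * m) ≤ k * m := by
    calc 4 * (2 * ⌊L⌋₊ * m) = 8 * ⌊L⌋₊ * m := by ring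
      _ ≤ k * m := by gcongr
  have hkm : m ≤ k * m := Nat.le_mul_of_pos_left m hk1
  -- At least half of `k * m` is left over, and `m ≥ 4 * N`; the surplus `2 ^ N` outweighs `1 / p`.
  have hEN : E + N ≤ k * m := by omega
  have h1 : p * 2 ^ (E + N) ≤ 2 ^ E := by
    refine le_trans ?_ hmain
    gcongr
    norm_num
  rw [pow_add] at h1
  have h2 : (0 : ℝ) < 2 ^ E := by positivity
  nlinarith

theorem mainTheorem4 :
    ∃ c : ℝ, 0 < c ∧
      ∀ p : ℝ, 0 < p →
        ∃ C : ℝ, 0 < C ∧ ∃ n₀ : ℕ,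
          ∀ n : ℕ, n₀ ≤ n → ∀ γ : ℕ, 1 ≤ γ → ∀ T : ℕ, ∀ task : HybridTask,
            ∀ (Ω : Type) [MeasurableSpace Ω] (μ : MeasureTheory.Measure Ω)
              [MeasureTheory.IsProbabilityMeasure μ]
              (A : HybridAlgorithm n Ω (List Bool × task.Fn n)),
              A.Computes task μ γ T p (c * (n : ℝ) ^ (2 / 3 : ℝ) * (γ : ℝ) ^ (1 / 3 : ℝ)) →
                C * ((n : ℝ) ^ (1 / 3 : ℝ) / (γ : ℝ) ^ (1 / 3 : ℝ)) ≤ (T : ℝ) := by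
  refine ⟨1 / 16, by norm_num, fun p hp => ⟨1 / 16, by norm_num, ?_⟩⟩
  obtain ⟨N, hN⟩ := pow_unbounded_of_one_lt (1 / p) (one_lt_two : (1 : ℝ) < 2)
  rw [div_lt_iff₀' hp] at hN
  refine ⟨16 * N + 8, fun n hn γ hγ T task Ω _ μ _ A hA => ?_⟩
  have hroot : ∀ x : ℕ, ((x : ℝ) ^ (1 / 3 : ℝ)) ^ 3 = x := fun x => by
    rw [← Real.rpow_natCast, ← Real.rpow_mul (Nat.cast_nonneg x)]
    norm_num
  have hsq : (n : ℝ) ^ (2 / 3 : ℝ) = ((n : ℝ) ^ (1 / 3 : ℝ)) ^ 2 := by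
    rw [← Real.rpow_natCast, ← Real.rpow_mul (Nat.cast_nonneg n)]
    norm_num
  have hg : 1 ≤ (γ : ℝ) ^ (1 / 3 : ℝ) :=
    Real.one_le_rpow (by exact_mod_cast hγ) (by norm_num)
  rw [hsq] at hA
  have := hA.cubeRoot_le hp hN hn (Real.rpow_nonneg (Nat.cast_nonneg n) _) (hroot n) hg (hroot γ)
  rw [← mul_div_assoc, div_le_iff₀ (by linarith)]
  linarith
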